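/- Let $\mathbb{D}=\{a+b\epsilon : a,b\in\mathbb{R}\}$ be the dual numbers and $\mathbb{DQ}=\{p+q\epsilon : p,q\in\mathbb{H}\}$ the dual quaternions, where $\epsilon^2=0$, $\epsilon$ commutes with everything, and $\mathbb H$ denotes the real quaternions; $(p+q\epsilon)^*=p^*+q^*\epsilon$, and $\mathbb{D}\subset\mathbb{DQ}$. An element of $\mathbb{D}$ or $\mathbb{DQ}$ is called appreciable if its standard part ($a$, respectively $p$) is nonzero; a vector in $\mathbb{DQ}^n$ is appreciable if at least one of its entries is. Appreciable elements are invertible. A right eigenvalue of $\hat A\in\mathbb{DQ}^{n\times n}$ is a $\mu\in\mathbb{DQ}$ with $\hat A\hat{\mathbf x}=\hat{\mathbf x}\mu$ for some appreciable $\hat{\mathbf x}\in\mathbb{DQ}^n$. For Hermitian $\hat A$ and appreciable $\hat{\mathbf v}\in\mathbb{DQ}^n$ the Rayleigh quotient is $\theta(\hat A,\hat{\mathbf v})=(\hat{\mathbf v}^*\hat A\hat{\mathbf v})(\hat{\mathbf v}^*\hat{\mathbf v})^{-1}$. **Proposition.** Let $\hat A\in\mathbb{DQ}^{n\times n}$ be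 Hermitian ($\hat A^*=\hat A$). Then there are vectors $\hat{\mathbf u}_1,\dots,\hat{\mathbf u}_n\in\mathbb{DQ}^n$ and dual numbers $\lambda_1,\dots,\lambda_n\in\mathbb{D}$ such that $\hat{\mathbf u}_i^*\hat{\mathbf u}_j=\delta_{ij}$ and $\hat A\hat{\mathbf u}_j=\hat{\mathbf u}_j\lambda_j$ for all $i,j$. For every such choice of $\hat{\mathbf u}_j$ and $\lambda_j$, the set of right eigenvalues of $\hat A$ is $\{\lambda_1,\dots,\lambda_n\}$; moreover every appreciable $\hat{\mathbf v}\in\mathbb{DQ}^n$ can be written in exactly one way as $\hat{\mathbf v}=\sum_{j=1}^n\hat{\mathbf u}_j\hat x_j$ with $\hat x_j\in\mathbb{DQ}$, the sum $\sum_j\hat x_j^*\hat x_j$ is an appreciable dual number, and $$\theta(\hat A,\hat{\mathbf v})=\frac{\sum_{j=1}^n\lambda_j\,\hat x_j^*\hat x_j}{\sum_{j=1}^n\hat x_j^*\hat x_j}.$$ -/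

import Mathlib

/-- Dual quaternions `p + q ε` with `p`, `q` real quaternions and `ε ^ 2 = 0`. The standard part
is `TrivSqZeroExt.fst`, the dual part is `TrivSqZeroExt.snd`. Mathlib's inverse on this type is
`(p + q ε)⁻¹ = p⁻¹ - p⁻¹ q p⁻¹ ε`. -/
abbrev DualQuaternion : Type := DualNumber (Quaternion ℝ)

namespace DualQuaternion

/-- The conjugate `(p + q ε)^* = p^* + q^* ε`. -/
instance instStarRing : StarRing DualQuaternion where
  star a := (star a.fst, star a.snd)
  star_involutive a := by
    refine TrivSqZeroExt.ext ?_ ?_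
    · exact star_star a.fst
    · exact star_star a.snd
  star_mul a b := by
    refine TrivSqZeroExt.ext ?_ ?_
    · exact star_mul a.fst b.fst
    · change star (a.fst * b.snd + a.snd * b.fst) =
        star b.fst * star a.snd + star b.snd * star a.fst
      rw [star_add, star_mul, star_mul, add_comm]
  star_add a b := by
    refine TrivSqZeroExt.ext ?_ ?_
    · exact star_add a.fst b.fst
    · exact star_add a.snd b.snd

/-- A dual number, regarded as a dual quaternion with real standard and dual parts. -/
noncomputable def ofDual (a : DualNumber ℝ) : DualQuaternion :=
  TrivSqZeroExt.inl ((TrivSqZeroExt.fst a : ℝ) : Quaternion ℝ) +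
    TrivSqZeroExt.inr ((TrivSqZeroExt.snd a : ℝ) : Quaternion ℝ)

/-- A dual quaternion vector is appreciable if its standard part is a nonzero vector. -/
def IsAppreciable {n : ℕ} (v : Fin n → DualQuaternion) : Prop :=
  ∃ i, TrivSqZeroExt.fst (v i) ≠ 0

/-- `μ` is a right eigenvalue of `A`: `A x = x μ` for some appreciable vector `x`. -/
def IsRightEigenvalue {n : ℕ} (A : Matrix (Fin n) (Fin n) DualQuaternion)
    (μ : DualQuaternion) : Prop :=
  ∃ x : Fin n → DualQuaternion, IsAppreciable x ∧ A.mulVec x = fun i => x i * μ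

/-- The right linear combination `∑ j, u j * x j` of the vectors `u j`. -/
noncomputable def rightCombination {n : ℕ} (u : Fin n → Fin n → DualQuaternion) (x : Fin n → DualQuaternion) :
    Fin n → DualQuaternion :=
  fun i => ∑ j, u j i * x j

/-- `u 0, …, u (n - 1)` are orthonormal (`(u i)^* (u j) = δ i j`) right eigenvectors of the
`n × n` matrix `A`, with the dual numbers `lam j` as eigenvalues: `A (u j) = (u j) (lam j)`. -/
structure IsOrthonormalEigenbasis {n : ℕ} (A : Matrix (Fin n) (Fin n) DualQuaternion)
    (u : Fin n → Fin n → DualQuaternion) (lam : Fin n → DualNumber ℝ) : Prop where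
  orthonormal : ∀ i j, dotProduct (star (u i)) (u j) = if i = j then 1 else 0
  eigen : ∀ j, A.mulVec (u j) = fun i => u j i * ofDual (lam j)

/-- The Rayleigh quotient `(v^* A v) / (v^* v)`, meant for Hermitian `A` and appreciable `v`. -/
noncomputable def rayleighQuotient {n : ℕ} (A : Matrix (Fin n) (Fin n) DualQuaternion)
    (v : Fin n → DualQuaternion) : DualQuaternion :=
  dotProduct (star v) (A.mulVec v) * (dotProduct (star v) v)⁻¹

end DualQuaternion

/-! ### Spectral theory of commuting Hermitian quaternion matrices. -/

namespace QuaternionMatrix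

open Quaternion Matrix

/-! Write `A = M + N ε` with `M`, `N` Hermitian over the quaternions. The real part of `x^* y` is a
real inner product for which Hermitian matrices are symmetric, so the real spectral theorem yields
orthonormal eigenvectors with real eigenvalues, and common ones for commuting pairs
(`exists_simultaneous_diagonalization`).

Diagonalizing `M` reduces to `d + N ε` with `d` real diagonal. Conjugation by the unitary `1 + P ε`,
`P` skew-Hermitian, replaces `N` by `N + d P - P d`. This can cancel each entry with `d i ≠ d j`
(`exists_commuting_part`); what remains commutes with `d`, and the two are diagonalized together.

A matrix `X` of orthonormal eigenvectors is unitary, so `X^* v` gives the unique coordinates and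
preserves `x^* y`. Dual numbers are central and an appreciable coordinate is a unit, so in these
coordinates the eigenvalue equation forces `μ = λ_j`, and the Rayleigh quotient becomes diagonal. -/

theorem re_sum {ι : Type*} (s : Finset ι) (f : ι → ℍ[ℝ]) :
    (∑ i ∈ s, f i).re = ∑ i ∈ s, (f i).re :=
  map_sum (AddMonoidHom.mk' (fun a : ℍ[ℝ] => a.re) Quaternion.re_add) f s

/-- The real inner product of two quaternion vectors is the real part of `x^* y`. -/
theorem inner_toLp {n : ℕ} (x y : PiLp 2 (fun _ : Fin n => ℍ[ℝ])) :
    inner ℝ x y = (star x.ofLp ⬝ᵥ y.ofLp).re := by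
  rw [PiLp.inner_apply, dotProduct, re_sum]
  refine Finset.sum_congr rfl fun i _ => ?_
  rw [Quaternion.inner_def, Pi.star_apply]
  simp only [Quaternion.re_mul, Quaternion.re_star, Quaternion.imI_star, Quaternion.imJ_star,
    Quaternion.imK_star]
  ring

/-- A quaternion matrix as a real-linear endomorphism of the Euclidean space `ℍ ^ n`. -/
noncomputable def toRealLin {n : ℕ} (C : Matrix (Fin n) (Fin n) ℍ[ℝ]) :
    PiLp 2 (fun _ : Fin n => ℍ[ℝ]) →ₗ[ℝ] PiLp 2 (fun _ : Fin n => ℍ[ℝ]) where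
  toFun x := WithLp.toLp 2 (C *ᵥ x.ofLp)
  map_add' x y := by
    rw [WithLp.ofLp_add, mulVec_add, WithLp.toLp_add]
  map_smul' r x := by
    rw [WithLp.ofLp_smul, mulVec_smul, WithLp.toLp_smul, RingHom.id_apply]

theorem isSymmetric_toRealLin {n : ℕ} {C : Matrix (Fin n) (Fin n) ℍ[ℝ]} (hC : C.IsHermitian) :
    (toRealLin C).IsSymmetric := by
  intro x y
  rw [inner_toLp, inner_toLp]
  change (star (C *ᵥ x.ofLp) ⬝ᵥ y.ofLp).re = (star x.ofLp ⬝ᵥ (C *ᵥ y.ofLp)).re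
  rw [star_mulVec, hC.eq, dotProduct_mulVec]

/-- A Hermitian quaternion matrix has an eigenvector with a real eigenvalue in every nonzero
invariant real subspace. -/
theorem exists_eigenvector {n : ℕ} {C : Matrix (Fin n) (Fin n) ℍ[ℝ]} (hC : C.IsHermitian)
    (W : Submodule ℝ (Fin n → ℍ[ℝ])) (hW : W ≠ ⊥) (hinv : ∀ w ∈ W, C *ᵥ w ∈ W) :
    ∃ w ∈ W, w ≠ 0 ∧ ∃ c : ℝ, C *ᵥ w = c • w := by
  let V : Submodule ℝ (PiLp 2 (fun _ : Fin n => ℍ[ℝ])) :=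
    W.comap (WithLp.linearEquiv 2 ℝ (Fin n → ℍ[ℝ])).toLinearMap
  have hV : ∀ v ∈ V, toRealLin C v ∈ V := fun v hv => hinv v.ofLp hv
  have hs := (isSymmetric_toRealLin hC).restrict_invariant hV
  obtain ⟨w, hw, hw0⟩ := W.exists_mem_ne_zero_of_ne_bot hW
  by_contra! hno
  -- A symmetric operator without eigenvalues acts on the zero space.
  have hsub : Subsingleton V := by
    refine hs.subsingleton_of_no_eigenvalue_finiteDimensional fun c => ?_
    rw [Submodule.eq_bot_iff]
    intro x hx
    by_contra hx0
    rw [Module.End.mem_eigenspace_iff] at hx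
    refine hno x.1.ofLp x.2 (fun h => hx0 ?_) c ?_
    · exact Subtype.ext ((WithLp.ofLp_injective 2) h)
    · exact congrArg (fun z : V => z.1.ofLp) hx
  have h := congrArg (fun z : V => z.1.ofLp)
    (hsub.elim ⟨WithLp.toLp 2 w, hw⟩ 0)
  exact hw0 h

/-- Two commuting Hermitian quaternion matrices have a common eigenvector with real eigenvalues in
every nonzero common invariant real subspace. -/
theorem exists_common_eigenvector {n : ℕ} {C B : Matrix (Fin n) (Fin n) ℍ[ℝ]}
    (hC : C.IsHermitian) (hB : B.IsHermitian) (hCB : C * B = B * C)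
    (W : Submodule ℝ (Fin n → ℍ[ℝ])) (hW : W ≠ ⊥)
    (hinvC : ∀ w ∈ W, C *ᵥ w ∈ W) (hinvB : ∀ w ∈ W, B *ᵥ w ∈ W) :
    ∃ w ∈ W, w ≠ 0 ∧ (∃ c : ℝ, C *ᵥ w = c • w) ∧ ∃ b : ℝ, B *ᵥ w = b • w := by
  obtain ⟨w, hw, hw0, c, hc⟩ := exists_eigenvector hC W hW hinvC
  -- The `c`-eigenspace of `C` in `W`; `B` preserves it since it commutes with `C`.
  let W' : Submodule ℝ (Fin n → ℍ[ℝ]) :=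
    { carrier := {x | x ∈ W ∧ C *ᵥ x = c • x}
      add_mem' := fun {x y} hx hy => ⟨W.add_mem hx.1 hy.1, by
        rw [mulVec_add, hx.2, hy.2, smul_add]⟩
      zero_mem' := ⟨W.zero_mem, by rw [mulVec_zero, smul_zero]⟩
      smul_mem' := fun r x hx => ⟨W.smul_mem r hx.1, by
        rw [mulVec_smul, hx.2, smul_comm]⟩ }
  have hW' : W' ≠ ⊥ := (Submodule.ne_bot_iff _).2 ⟨w, ⟨hw, hc⟩, hw0⟩
  obtain ⟨x, hx, hx0, b, hb⟩ := exists_eigenvector hB W' hW' fun x hx => ⟨hinvB x hx.1, by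
    rw [mulVec_mulVec, hCB, ← mulVec_mulVec, hx.2, mulVec_smul]⟩
  exact ⟨x, hx.1, hx0, ⟨c, hx.2⟩, b, hb⟩

theorem star_real_smul {n : ℕ} (r : ℝ) (w : Fin n → ℍ[ℝ]) : star (r • w) = r • star w :=
  funext fun i => Quaternion.star_smul r (w i)

theorem star_dotProduct_self {n : ℕ} (w : Fin n → ℍ[ℝ]) :
    star w ⬝ᵥ w = ((∑ i, normSq (w i) : ℝ) : ℍ[ℝ]) := by
  refine Eq.trans ?_ (map_sum (algebraMap ℝ ℍ[ℝ]) (fun i => normSq (w i)) Finset.univ).symm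
  exact Finset.sum_congr rfl fun i _ => Quaternion.star_mul_self _

theorem sum_normSq_pos {n : ℕ} {w : Fin n → ℍ[ℝ]} (hw : w ≠ 0) : 0 < ∑ i, normSq (w i) := by
  obtain ⟨i, hi⟩ := Function.ne_iff.1 hw
  exact Finset.sum_pos' (fun _ _ => normSq_nonneg)
    ⟨i, Finset.mem_univ i, normSq_nonneg.lt_of_ne' (normSq_ne_zero.2 hi)⟩

/-- The real subspace of vectors orthogonal to the family `u`. -/
def orthogonalTo {n k : ℕ} (u : Fin k → Fin n → ℍ[ℝ]) : Submodule ℝ (Fin n → ℍ[ℝ]) where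
  carrier := {w | ∀ i, star (u i) ⬝ᵥ w = 0}
  add_mem' := fun {x y} hx hy i => by rw [dotProduct_add, hx i, hy i, add_zero]
  zero_mem' := fun i => dotProduct_zero _
  smul_mem' := fun r x hx i => by rw [dotProduct_smul, hx i, smul_zero]

/-- Real dimension count: the map `w ↦ (u_i^* w)_i` goes from dimension `4n` to `4k`, so it has a
kernel. -/
theorem orthogonalTo_ne_bot {n k : ℕ} (hk : k < n) (u : Fin k → Fin n → ℍ[ℝ]) :
    orthogonalTo u ≠ ⊥ := by
  let f : (Fin n → ℍ[ℝ]) →ₗ[ℝ] (Fin k → ℍ[ℝ]) :=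
    { toFun := fun w i => star (u i) ⬝ᵥ w
      map_add' := fun x y => funext fun i => dotProduct_add _ _ _
      map_smul' := fun r x => funext fun i => dotProduct_smul _ _ _ }
  have hf : LinearMap.ker f ≠ ⊥ := by
    refine LinearMap.ker_ne_bot_of_finrank_lt ?_
    rw [Module.finrank_pi_fintype, Module.finrank_pi_fintype]
    simp [Quaternion.finrank_eq_four, hk]
  obtain ⟨w, hw, hw0⟩ := Submodule.exists_mem_ne_zero_of_ne_bot hf
  exact (Submodule.ne_bot_iff _).2 ⟨w, fun i => congrFun (LinearMap.mem_ker.1 hw) i, hw0⟩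

theorem mulVec_mem_orthogonalTo {n k : ℕ} {C : Matrix (Fin n) (Fin n) ℍ[ℝ]} (hC : C.IsHermitian)
    {u : Fin k → Fin n → ℍ[ℝ]} {c : Fin k → ℝ} (hu : ∀ j, C *ᵥ u j = c j • u j)
    {w : Fin n → ℍ[ℝ]} (hw : w ∈ orthogonalTo u) : C *ᵥ w ∈ orthogonalTo u := by
  intro i
  have h : star (C *ᵥ u i) ⬝ᵥ w = 0 := by
    rw [hu i, star_real_smul, smul_dotProduct, hw i, smul_zero]
  rwa [star_mulVec, hC.eq, ← dotProduct_mulVec] at h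

/-- Induction on `k`: both matrices preserve the orthogonal complement of the eigenvectors already
found, so it contains a further common eigenvector, which is then normalized. -/
theorem exists_orthonormal_common_eigenvectors {n : ℕ} {C B : Matrix (Fin n) (Fin n) ℍ[ℝ]}
    (hC : C.IsHermitian) (hB : B.IsHermitian) (hCB : C * B = B * C) (k : ℕ) (hk : k ≤ n) :
    ∃ (u : Fin k → Fin n → ℍ[ℝ]) (c b : Fin k → ℝ),
      (∀ i j, star (u i) ⬝ᵥ u j = if i = j then 1 else 0) ∧
      (∀ j, C *ᵥ u j = c j • u j) ∧ ∀ j, B *ᵥ u j = b j • u j := by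
  induction k with
  | zero => exact ⟨Fin.elim0, Fin.elim0, Fin.elim0, fun i => i.elim0, fun i => i.elim0,
      fun i => i.elim0⟩
  | succ k ih =>
    obtain ⟨u, c, b, huu, huc, hub⟩ := ih (Nat.le_of_succ_le hk)
    obtain ⟨w, hw, hw0, ⟨c', hc'⟩, b', hb'⟩ := exists_common_eigenvector hC hB hCB
      (orthogonalTo u) (orthogonalTo_ne_bot hk u)
      (fun w hw => mulVec_mem_orthogonalTo hC huc hw)
      (fun w hw => mulVec_mem_orthogonalTo hB hub hw)
    set s : ℝ := ∑ i, normSq (w i) with hs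
    have hspos : 0 < s := sum_normSq_pos hw0
    set r : ℝ := (√s)⁻¹ with hr
    have hrs : r * (r * s) = 1 := by
      rw [hr]
      nth_rewrite 3 [← Real.mul_self_sqrt hspos.le]
      have := (Real.sqrt_pos.2 hspos).ne'
      field_simp
    have hrw : r • w ∈ orthogonalTo u := Submodule.smul_mem _ r hw
    have hrw' : ∀ i, star (r • w) ⬝ᵥ u i = 0 := fun i => by
      rw [star_dotProduct, hrw i, star_zero]
    refine ⟨Fin.snoc u (r • w), Fin.snoc c c', Fin.snoc b b', ?_, ?_, ?_⟩
    · intro i j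
      refine Fin.lastCases ?_ (fun i => ?_) i <;> refine Fin.lastCases ?_ (fun j => ?_) j
      · rw [Fin.snoc_last, if_pos rfl, star_real_smul, smul_dotProduct, dotProduct_smul,
          star_dotProduct_self, ← Quaternion.coe_smul, ← Quaternion.coe_smul,
          smul_eq_mul, smul_eq_mul, hrs, Quaternion.coe_one]
      · rw [Fin.snoc_last, Fin.snoc_castSucc, if_neg (Fin.castSucc_lt_last j).ne', hrw' j]
      · rw [Fin.snoc_last, Fin.snoc_castSucc, if_neg (Fin.castSucc_lt_last i).ne, hrw i]
      · simp only [Fin.snoc_castSucc, huu, Fin.castSucc_inj]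
    · intro j
      refine Fin.lastCases ?_ (fun j => ?_) j
      · simp only [Fin.snoc_last]
        rw [mulVec_smul, hc', smul_comm]
      · simp only [Fin.snoc_castSucc, huc]
    · intro j
      refine Fin.lastCases ?_ (fun j => ?_) j
      · simp only [Fin.snoc_last]
        rw [mulVec_smul, hb', smul_comm]
      · simp only [Fin.snoc_castSucc, hub]

/-- The quaternion diagonal matrix with the given real entries. -/
noncomputable def realDiagonal {n : ℕ} (d : Fin n → ℝ) : Matrix (Fin n) (Fin n) ℍ[ℝ] :=
  diagonal fun i => (d i : ℍ[ℝ])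

theorem isHermitian_realDiagonal {n : ℕ} (d : Fin n → ℝ) : (realDiagonal d).IsHermitian :=
  isHermitian_diagonal_of_self_adjoint _ (funext fun _ => Quaternion.star_coe _)

/-- Two commuting Hermitian quaternion matrices are simultaneously unitarily diagonalizable, with
real eigenvalues. -/
theorem exists_simultaneous_diagonalization {n : ℕ} {C B : Matrix (Fin n) (Fin n) ℍ[ℝ]}
    (hC : C.IsHermitian) (hB : B.IsHermitian) (hCB : C * B = B * C) :
    ∃ (U : Matrix (Fin n) (Fin n) ℍ[ℝ]) (c b : Fin n → ℝ),
      Uᴴ * U = 1 ∧ C * U = U * realDiagonal c ∧ B * U = U * realDiagonal b := by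
  obtain ⟨u, c, b, huu, huc, hub⟩ :=
    exists_orthonormal_common_eigenvectors hC hB hCB n le_rfl
  refine ⟨of fun i j => u j i, c, b, ?_, ?_, ?_⟩
  · ext1 i j
    rw [one_apply]
    exact huu i j
  · ext1 i j
    rw [realDiagonal, mul_diagonal]
    refine (congrFun (huc j) i).trans ?_
    rw [Pi.smul_apply, ← Quaternion.mul_coe_eq_smul, of_apply]
  · ext1 i j
    rw [realDiagonal, mul_diagonal]
    refine (congrFun (hub j) i).trans ?_
    rw [Pi.smul_apply, ← Quaternion.mul_coe_eq_smul, of_apply]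

end QuaternionMatrix
-- Dual quaternion matrices and their unitary diagonalization.
namespace DualQuaternion

open Quaternion Matrix QuaternionMatrix

/-- The dual quaternion matrix `M + N ε`. -/
def dualMatrix {n : ℕ} (M N : Matrix (Fin n) (Fin n) ℍ[ℝ]) :
    Matrix (Fin n) (Fin n) DualQuaternion :=
  of fun i j => (M i j, N i j)

theorem dualMatrix_mul {n : ℕ} (M N M' N' : Matrix (Fin n) (Fin n) ℍ[ℝ]) :
    dualMatrix M N * dualMatrix M' N' = dualMatrix (M * M') (M * N' + N * M') := by
  ext1 i j
  refine TrivSqZeroExt.ext ?_ ?_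
  · rw [mul_apply, TrivSqZeroExt.fst_sum]
    rfl
  · rw [mul_apply, TrivSqZeroExt.snd_sum]
    change _ = (M * N') i j + (N * M') i j
    rw [mul_apply, mul_apply, ← Finset.sum_add_distrib]
    rfl

theorem conjTranspose_dualMatrix {n : ℕ} (M N : Matrix (Fin n) (Fin n) ℍ[ℝ]) :
    (dualMatrix M N)ᴴ = dualMatrix Mᴴ Nᴴ := rfl

theorem dualMatrix_one_zero {n : ℕ} :
    dualMatrix (1 : Matrix (Fin n) (Fin n) ℍ[ℝ]) 0 = 1 := by
  ext1 i j
  rw [one_apply]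
  change ((1 : Matrix (Fin n) (Fin n) ℍ[ℝ]) i j, (0 : ℍ[ℝ])) = _
  rw [one_apply]
  split_ifs <;> rfl

theorem dualMatrix_realDiagonal {n : ℕ} (c b : Fin n → ℝ) :
    dualMatrix (realDiagonal c) (realDiagonal b) =
      diagonal fun j => ofDual ((c j, b j) : DualNumber ℝ) := by
  ext1 i j
  change ((realDiagonal c) i j, (realDiagonal b) i j) = _
  rw [realDiagonal, realDiagonal, diagonal_apply, diagonal_apply, diagonal_apply]
  split_ifs
  · refine TrivSqZeroExt.ext ?_ ?_
    · exact (add_zero _).symm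
    · exact (zero_add _).symm
  · rfl

theorem dualMatrix_isHermitian_iff {n : ℕ} {M N : Matrix (Fin n) (Fin n) ℍ[ℝ]} :
    (dualMatrix M N).IsHermitian ↔ M.IsHermitian ∧ N.IsHermitian := by
  constructor
  · intro h
    exact ⟨Matrix.ext fun i j => congrArg TrivSqZeroExt.fst (congrFun (congrFun h i) j),
      Matrix.ext fun i j => congrArg TrivSqZeroExt.snd (congrFun (congrFun h i) j)⟩
  · intro h
    rw [IsHermitian, conjTranspose_dualMatrix, h.1.eq, h.2.eq]

theorem dualMatrix_fst_snd {n : ℕ} (A : Matrix (Fin n) (Fin n) DualQuaternion) :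
    dualMatrix (A.map TrivSqZeroExt.fst) (A.map TrivSqZeroExt.snd) = A := rfl

/-- The part of a Hermitian matrix that does not commute with a real diagonal matrix is a
commutator of the diagonal matrix with a skew-Hermitian one. -/
theorem exists_commuting_part {n : ℕ} (d : Fin n → ℝ) {N : Matrix (Fin n) (Fin n) ℍ[ℝ]}
    (hN : N.IsHermitian) :
    ∃ B P : Matrix (Fin n) (Fin n) ℍ[ℝ], B.IsHermitian ∧
      realDiagonal d * B = B * realDiagonal d ∧ Pᴴ = -P ∧
      realDiagonal d * P + N = P * realDiagonal d + B := by
  -- Entrywise, `d i * P i j + N i j = P i j * d j + B i j` is solved by division when `d i ≠ d j`.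
  -- Otherwise `0⁻¹ = 0` makes `P i j = 0`, which keeps `P` skew-Hermitian, and `B` retains the
  -- entry.
  refine ⟨of fun i j => if d i = d j then N i j else 0,
    of fun i j => (d j - d i)⁻¹ • N i j, ?_, ?_, ?_, ?_⟩
  · ext1 i j
    rw [conjTranspose_apply, of_apply, of_apply, apply_ite star, star_zero, hN.apply]
    simp only [eq_comm]
  · ext1 i j
    rw [realDiagonal, diagonal_mul, mul_diagonal, of_apply]
    split_ifs with h
    · rw [h, Quaternion.coe_commutes]
    · rw [mul_zero, zero_mul]
  · ext1 i j
    rw [conjTranspose_apply, neg_apply, of_apply, of_apply, Quaternion.star_smul, hN.apply,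
      ← neg_sub (d j), inv_neg, neg_smul]
  · ext1 i j
    rw [realDiagonal, Matrix.add_apply, Matrix.add_apply, diagonal_mul, mul_diagonal, of_apply, of_apply,
      Quaternion.coe_mul_eq_smul, Quaternion.mul_coe_eq_smul, smul_smul, smul_smul]
    split_ifs with h
    · rw [h]
    · have h' : d j - d i ≠ 0 := sub_ne_zero.2 (Ne.symm h)
      rw [add_zero]
      nth_rewrite 2 [← one_smul ℝ (N i j)]
      rw [← add_smul]
      congr 1
      field_simp
      ring

/-- A Hermitian dual quaternion matrix is unitarily diagonalizable with dual number eigenvalues. -/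
theorem exists_unitary_diagonalization {n : ℕ} {A : Matrix (Fin n) (Fin n) DualQuaternion}
    (hA : A.IsHermitian) :
    ∃ (X : Matrix (Fin n) (Fin n) DualQuaternion) (lam : Fin n → DualNumber ℝ),
      Xᴴ * X = 1 ∧ A * X = X * diagonal fun j => ofDual (lam j) := by
  obtain ⟨M, N, rfl⟩ : ∃ M N, dualMatrix M N = A := ⟨_, _, dualMatrix_fst_snd A⟩
  obtain ⟨hM, hN⟩ := dualMatrix_isHermitian_iff.1 hA
  -- The pair `M`, `M` gives the spectral theorem for `M` alone.
  obtain ⟨U, d, -, hU, hMU, -⟩ := exists_simultaneous_diagonalization hM hM rfl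
  have hU' : U * Uᴴ = 1 := mul_eq_one_comm.1 hU
  obtain ⟨B, P, hB, hdB, hP, hBP⟩ :=
    exists_commuting_part d (isHermitian_conjTranspose_mul_mul U hN)
  obtain ⟨V, c, b, hV, hVc, hVb⟩ :=
    exists_simultaneous_diagonalization (isHermitian_realDiagonal d) hB hdB
  -- The conjugating matrix is `U (1 + P ε)`; it is unitary because `P^* + P = 0`.
  have h1 : dualMatrix M N * dualMatrix U (U * P) =
      dualMatrix U (U * P) * dualMatrix (realDiagonal d) B := by
    rw [dualMatrix_mul, dualMatrix_mul, hMU]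
    congr 1
    have hN' : N * U = U * (Uᴴ * N * U) := by
      rw [mul_assoc Uᴴ, ← mul_assoc U, hU', one_mul]
    rw [← mul_assoc M, hMU, hN', mul_assoc, ← mul_add, hBP, mul_add, mul_assoc, add_comm]
  have h2 : dualMatrix (realDiagonal d) B * dualMatrix V 0 =
      dualMatrix V 0 * dualMatrix (realDiagonal c) (realDiagonal b) := by
    rw [dualMatrix_mul, dualMatrix_mul, hVc, hVb, mul_zero, zero_mul, zero_add, add_zero]
  have h3 : (dualMatrix U (U * P))ᴴ * dualMatrix U (U * P) = 1 := by
    rw [conjTranspose_dualMatrix, dualMatrix_mul, conjTranspose_mul, hP, hU, ← mul_assoc, hU,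
      mul_assoc, hU, one_mul, mul_one, add_neg_cancel, dualMatrix_one_zero]
  have h4 : (dualMatrix V 0)ᴴ * dualMatrix V 0 = 1 := by
    rw [conjTranspose_dualMatrix, dualMatrix_mul, conjTranspose_zero, mul_zero, zero_mul,
      add_zero, hV, dualMatrix_one_zero]
  refine ⟨dualMatrix U (U * P) * dualMatrix V 0, fun j => (c j, b j), ?_, ?_⟩
  · rw [conjTranspose_mul, mul_assoc, ← mul_assoc _ _ (dualMatrix V 0), h3, one_mul, h4]
  · rw [← dualMatrix_realDiagonal, ← mul_assoc, h1, mul_assoc, h2, mul_assoc]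

/-- The matrix whose columns are the vectors `u j`. -/
def columnMatrix {n : ℕ} (u : Fin n → Fin n → DualQuaternion) :
    Matrix (Fin n) (Fin n) DualQuaternion :=
  of fun i j => u j i

theorem isOrthonormalEigenbasis_iff {n : ℕ} {A : Matrix (Fin n) (Fin n) DualQuaternion}
    {u : Fin n → Fin n → DualQuaternion} {lam : Fin n → DualNumber ℝ} :
    IsOrthonormalEigenbasis A u lam ↔ (columnMatrix u)ᴴ * columnMatrix u = 1 ∧
      A * columnMatrix u = columnMatrix u * diagonal fun j => ofDual (lam j) := by
  constructor
  · rintro ⟨h1, h2⟩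
    refine ⟨Matrix.ext fun i j => ?_, Matrix.ext fun i j => ?_⟩
    · rw [one_apply]
      exact h1 i j
    · rw [mul_diagonal]
      exact congrFun (h2 j) i
  · rintro ⟨h1, h2⟩
    refine ⟨fun i j => ?_, fun j => funext fun i => ?_⟩
    · have := congrFun (congrFun h1 i) j
      rwa [one_apply] at this
    · have := congrFun (congrFun h2 i) j
      rwa [mul_diagonal] at this

theorem rightCombination_eq_mulVec {n : ℕ} (u : Fin n → Fin n → DualQuaternion)
    (x : Fin n → DualQuaternion) : rightCombination u x = columnMatrix u *ᵥ x := rfl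

theorem fst_ofDual (a : DualNumber ℝ) :
    TrivSqZeroExt.fst (ofDual a) = ((TrivSqZeroExt.fst a : ℝ) : ℍ[ℝ]) := add_zero _

theorem snd_ofDual (a : DualNumber ℝ) :
    TrivSqZeroExt.snd (ofDual a) = ((TrivSqZeroExt.snd a : ℝ) : ℍ[ℝ]) := zero_add _

theorem ofDual_commutes (a : DualNumber ℝ) (x : DualQuaternion) :
    ofDual a * x = x * ofDual a := by
  refine TrivSqZeroExt.ext ?_ ?_
  · rw [TrivSqZeroExt.fst_mul, TrivSqZeroExt.fst_mul, fst_ofDual, Quaternion.coe_commutes]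
  · change TrivSqZeroExt.fst (ofDual a) * x.snd + TrivSqZeroExt.snd (ofDual a) * x.fst =
      x.fst * TrivSqZeroExt.snd (ofDual a) + x.snd * TrivSqZeroExt.fst (ofDual a)
    rw [fst_ofDual, snd_ofDual, Quaternion.coe_commutes, Quaternion.coe_commutes, add_comm]

theorem mulVec_mul_right {n : ℕ} (A : Matrix (Fin n) (Fin n) DualQuaternion)
    (x : Fin n → DualQuaternion) (μ : DualQuaternion) :
    (A *ᵥ fun i => x i * μ) = fun i => (A *ᵥ x) i * μ := by
  funext i
  simp only [mulVec, dotProduct, Finset.sum_mul, mul_assoc]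

/-- Standard parts multiply, so a vector with zero standard part has an image with zero standard
part. -/
theorem isAppreciable_of_mulVec {n : ℕ} {A : Matrix (Fin n) (Fin n) DualQuaternion}
    {x : Fin n → DualQuaternion} (h : IsAppreciable (A *ᵥ x)) : IsAppreciable x := by
  obtain ⟨i, hi⟩ := h
  by_contra hx
  simp only [IsAppreciable, not_exists, not_not] at hx
  refine hi ?_
  rw [mulVec, dotProduct, TrivSqZeroExt.fst_sum]
  exact Finset.sum_eq_zero fun j _ => by rw [TrivSqZeroExt.fst_mul, hx j, mul_zero]

/-- For an appreciable vector `x`, `x^* x` is an appreciable dual number. -/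
theorem exists_ofDual_eq_star_dotProduct {n : ℕ} {x : Fin n → DualQuaternion}
    (hx : IsAppreciable x) :
    ∃ d : DualNumber ℝ, TrivSqZeroExt.fst d ≠ 0 ∧ ∑ j, star (x j) * x j = ofDual d := by
  let p : Fin n → ℍ[ℝ] := fun j => TrivSqZeroExt.fst (x j)
  let q : Fin n → ℍ[ℝ] := fun j => TrivSqZeroExt.snd (x j)
  -- The dual part of `(p + q ε)^* (p + q ε)` is `p^* q + q^* p`, a quaternion plus its conjugate.
  let d : DualNumber ℝ := (∑ j, normSq (p j), ∑ j, 2 * (star (p j) * q j).re)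
  refine ⟨d, ?_, ?_⟩
  · obtain ⟨i, hi⟩ := hx
    exact (sum_normSq_pos (w := p) fun h => hi (congrFun h i)).ne'
  · refine TrivSqZeroExt.ext ?_ ?_
    · exact (TrivSqZeroExt.fst_sum _ _).trans ((star_dotProduct_self p).trans (fst_ofDual d).symm)
    · refine (TrivSqZeroExt.snd_sum _ _).trans (Eq.trans ?_ (snd_ofDual d).symm)
      refine Eq.trans (Finset.sum_congr rfl fun j _ => ?_)
        (map_sum (algebraMap ℝ ℍ[ℝ]) (fun j => 2 * (star (p j) * q j).re) Finset.univ).symm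
      change star (p j) * q j + star (q j) * p j = ((2 * (star (p j) * q j).re : ℝ) : ℍ[ℝ])
      rw [← Quaternion.self_add_star', star_mul, star_star]

/-! ### Coordinates, right eigenvalues and Rayleigh quotients in an eigenbasis. -/

section Eigenbasis

variable {n : ℕ} {A : Matrix (Fin n) (Fin n) DualQuaternion}
  {u : Fin n → Fin n → DualQuaternion} {lam : Fin n → DualNumber ℝ}

theorem IsOrthonormalEigenbasis.eq_rightCombination_iff (h : IsOrthonormalEigenbasis A u lam)
    (v x : Fin n → DualQuaternion) :
    v = rightCombination u x ↔ x = (columnMatrix u)ᴴ *ᵥ v := by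
  obtain ⟨h1, -⟩ := isOrthonormalEigenbasis_iff.1 h
  rw [rightCombination_eq_mulVec]
  constructor
  · rintro rfl
    rw [mulVec_mulVec, h1, one_mulVec]
  · rintro rfl
    rw [mulVec_mulVec, mul_eq_one_comm.1 h1, one_mulVec]

theorem IsOrthonormalEigenbasis.isRightEigenvalue (h : IsOrthonormalEigenbasis A u lam)
    (j : Fin n) : IsRightEigenvalue A (ofDual (lam j)) := by
  refine ⟨u j, ?_, h.eigen j⟩
  by_contra hu
  simp only [IsAppreciable, not_exists, not_not] at hu
  have h1 := congrArg TrivSqZeroExt.fst (h.orthonormal j j)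
  rw [if_pos rfl, dotProduct, TrivSqZeroExt.fst_sum, TrivSqZeroExt.fst_one] at h1
  refine zero_ne_one (α := ℍ[ℝ]) (Eq.trans (Eq.symm ?_) h1)
  exact Finset.sum_eq_zero fun i _ => by rw [TrivSqZeroExt.fst_mul, hu i, mul_zero]

theorem IsOrthonormalEigenbasis.mulVec_rightCombination (h : IsOrthonormalEigenbasis A u lam)
    (x : Fin n → DualQuaternion) :
    A *ᵥ rightCombination u x = rightCombination u fun j => ofDual (lam j) * x j := by
  obtain ⟨-, h2⟩ := isOrthonormalEigenbasis_iff.1 h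
  rw [rightCombination_eq_mulVec, rightCombination_eq_mulVec, mulVec_mulVec, h2,
    ← mulVec_mulVec]
  congr 1
  funext j
  exact mulVec_diagonal _ _ _

theorem IsOrthonormalEigenbasis.rightCombination_injective (h : IsOrthonormalEigenbasis A u lam)
    {x y : Fin n → DualQuaternion} (hxy : rightCombination u x = rightCombination u y) :
    x = y :=
  ((h.eq_rightCombination_iff _ x).1 rfl).trans ((h.eq_rightCombination_iff _ y).1 hxy).symm

theorem IsOrthonormalEigenbasis.exists_eq_of_isRightEigenvalue
    (h : IsOrthonormalEigenbasis A u lam) {μ : DualQuaternion} (hμ : IsRightEigenvalue A μ) :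
    ∃ j, ofDual (lam j) = μ := by
  obtain ⟨v, hv, hvμ⟩ := hμ
  obtain ⟨x, rfl⟩ : ∃ x, v = rightCombination u x := ⟨_, (h.eq_rightCombination_iff v _).2 rfl⟩
  obtain ⟨j, hj⟩ := isAppreciable_of_mulVec (A := columnMatrix u) hv
  rw [h.mulVec_rightCombination, rightCombination_eq_mulVec u x, ← mulVec_mul_right] at hvμ
  have hx : ofDual (lam j) * x j = x j * μ :=
    congrFun (h.rightCombination_injective hvμ) j
  -- The coordinate `x j` has nonzero standard part, hence is a unit and cancels from `x j * λ_j = x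
  -- j * μ`.
  refine ⟨j, ((TrivSqZeroExt.isUnit_iff_isUnit_fst.2 (isUnit_iff_ne_zero.2 hj)).mul_left_cancel
    ?_)⟩
  rw [← hx, ofDual_commutes]

theorem IsOrthonormalEigenbasis.star_dotProduct_rightCombination
    (h : IsOrthonormalEigenbasis A u lam) (x y : Fin n → DualQuaternion) :
    star (rightCombination u x) ⬝ᵥ rightCombination u y = star x ⬝ᵥ y := by
  obtain ⟨h1, -⟩ := isOrthonormalEigenbasis_iff.1 h
  rw [rightCombination_eq_mulVec, rightCombination_eq_mulVec, star_mulVec, ← dotProduct_mulVec,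
    mulVec_mulVec, h1, one_mulVec]

theorem IsOrthonormalEigenbasis.rayleighQuotient_rightCombination
    (h : IsOrthonormalEigenbasis A u lam) (x : Fin n → DualQuaternion) :
    rayleighQuotient A (rightCombination u x) =
      (∑ j, ofDual (lam j) * (star (x j) * x j)) * (∑ j, star (x j) * x j)⁻¹ := by
  rw [rayleighQuotient, h.mulVec_rightCombination, h.star_dotProduct_rightCombination,
    h.star_dotProduct_rightCombination]
  congr 1
  refine Finset.sum_congr rfl fun j _ => ?_
  rw [← mul_assoc (ofDual _), ofDual_commutes _ (star (x j)), mul_assoc]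
  rfl

end Eigenbasis

end DualQuaternion

theorem mainTheorem6 (n : ℕ) (A : Matrix (Fin n) (Fin n) DualQuaternion) (hA : A.IsHermitian) :
    (∃ (u : Fin n → Fin n → DualQuaternion) (lam : Fin n → DualNumber ℝ),
      DualQuaternion.IsOrthonormalEigenbasis A u lam) ∧
    ∀ (u : Fin n → Fin n → DualQuaternion) (lam : Fin n → DualNumber ℝ),
      DualQuaternion.IsOrthonormalEigenbasis A u lam →
      {μ | DualQuaternion.IsRightEigenvalue A μ} =
        Set.range (fun j => DualQuaternion.ofDual (lam j)) ∧
      ∀ v : Fin n → DualQuaternion, DualQuaternion.IsAppreciable v →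
        (∃! x : Fin n → DualQuaternion, v = DualQuaternion.rightCombination u x) ∧
        ∀ x : Fin n → DualQuaternion, v = DualQuaternion.rightCombination u x →
          (∃ d : DualNumber ℝ, TrivSqZeroExt.fst d ≠ 0 ∧
            ∑ j, star (x j) * x j = DualQuaternion.ofDual d) ∧
          DualQuaternion.rayleighQuotient A v =
            (∑ j, DualQuaternion.ofDual (lam j) * (star (x j) * x j)) *
              (∑ j, star (x j) * x j)⁻¹ := by
  refine ⟨?_, fun u lam h => ⟨?_, fun v hv => ⟨?_, ?_⟩⟩⟩
  · obtain ⟨X, lam, hX⟩ := DualQuaternion.exists_unitary_diagonalization hA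
    exact ⟨fun j i => X i j, lam, DualQuaternion.isOrthonormalEigenbasis_iff.2 hX⟩
  · ext μ
    refine ⟨h.exists_eq_of_isRightEigenvalue, ?_⟩
    rintro ⟨j, rfl⟩
    exact h.isRightEigenvalue j
  · exact ⟨_, (h.eq_rightCombination_iff v _).2 rfl,
      fun y hy => (h.eq_rightCombination_iff v y).1 hy⟩
  · rintro x rfl
    exact ⟨DualQuaternion.exists_ofDual_eq_star_dotProduct
      (DualQuaternion.isAppreciable_of_mulVec (A := DualQuaternion.columnMatrix u) hv),
      h.rayleighQuotient_rightCombination x⟩
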